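/- **Setting.** Let $\mathcal R=K[x_1,\dots,x_n]$ be a polynomial ring over a field, $f_1,\dots,f_m\in\mathcal R$, $I=\langle f_1,\dots,f_m\rangle$, let $e_1,\dots,e_m$ be the unit vectors of $\mathcal R^m$, and write $\bar\alpha=\sum_i a_if_i$ for $\alpha=\sum_i a_ie_i\in\mathcal R^m$. Let $\mathrm{Syz}(f_1,\dots,f_m)=\{\alpha:\bar\alpha=0\}$; its elements are called syzygies. Let $\le$ be a monomial order on $\mathcal R$ together with a compatible module monomial order on $\mathcal R^m$, i.e. a well-order on the module monomials $x^ve_i$ such that $S\le T$ implies $cS\le cT$ for all monomials $c$, and such that $a\le b\iff ae_i\le be_i$ for all monomials $a,b$ and all $i$. Orders compare terms by their monomials, ignoring coefficients; $\simeq$ is equality up to a non-zero scalar; $\mathrm{hd}$ is the lead term of a non-zero polynomial, and the signature $\mathfrak s(\alpha)$ of $\alpha\neq0$ is its $\le$-maximal term. **s-reduction.** Let $\mathcal G\subset\mathcal R^m$ be finite. If $t$ is a term of $\bar\alpha$, $\beta\in\mathcal G$, and $b$ is a monomial times a non-zero scalar with $\mathrm{hd}(\overline{b\beta})=t$ and $\mathfrak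 s(b\beta)\le\mathfrak s(\alpha)$, then $\alpha\mapsto\alpha-b\beta$ is an s-reduction step w.r.t. $\mathcal G$. It is *singular* if $\mathfrak s(b\beta)\simeq\mathfrak s(\alpha)$ and *regular* otherwise, and a *top* step if $t=\mathrm{hd}(\bar\alpha)$. The element $\alpha$ s-reduces to zero if some sequence of s-reduction steps leads from $\alpha$ to a syzygy. The set $\mathcal G$ is a *signature Gröbner basis for $I$* if every non-zero $\alpha\in\mathcal R^m$ s-reduces to zero w.r.t. $\mathcal G$. A finite set $\mathcal H\subset N$ is a *Gröbner basis* of a submodule $N\subseteq\mathcal R^m$ if every element of $N$ reduces to $0$ by steps $\alpha\mapsto\alpha-b\eta$ with $\eta\in\mathcal H$ and $b$ a monomial times a non-zero scalar such that the lead term $\mathfrak s(b\eta)$ is a term of $\alpha$. **S-pairs.** For $\bar\alpha,\bar\beta\ne0$ let $\lambda$ be the monic least common multiple of $\mathrm{hd}(\bar\alpha),\mathrm{hd}(\bar\beta)$. The S-pair is $\mathrm{spair}(\alpha,\beta)=\frac{\lambda}{\mathrm{hd}(\bar\alpha)}\alpha-\frac{\lambda}{\mathrm{hd}(\bar\beta)}\beta\in\mathcal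 R^m$; it is regular if the signatures of the two summands are not $\simeq$. **Algorithm genSB.** Let $\preceq$ be a total order on the S-pairs and unit vectors (elements of $\mathcal R^m$). Start with $\mathcal G=\mathcal H=\emptyset$, $\mathcal P=\{e_1,\dots,e_m\}$. While $\mathcal P\ne\emptyset$: remove $\beta=\min_\preceq\mathcal P$ from $\mathcal P$; apply regular s-reduction steps w.r.t. $\mathcal G$ (to any terms, with any choice of reducers) to $\beta$ until the result $\gamma$ admits none. If $\bar\gamma=0$, add $\gamma$ to $\mathcal H$. Otherwise, if $\gamma$ admits no singular top s-reduction step w.r.t. $\mathcal G$, add to $\mathcal P$ all regular S-pairs $\mathrm{spair}(\alpha,\gamma)$ with $\alpha\in\mathcal G$, and then add $\gamma$ to $\mathcal G$. At the end return $(\mathcal G,\mathcal H)$. **Theorem.** For all $f_1,\dots,f_m$, every monomial order on $\mathcal R$ with a compatible module monomial order on $\mathcal R^m$, every total order $\preceq$, and all choices made in the reductions, genSB terminates after finitely many steps (reduction steps included). The returned set $\mathcal G$ is a signature Gröbner basis for $I$, and the returned set $\mathcal H$ is a Gröbner basis of $\mathrm{Syz}(f_1,\dots,f_m)$; in particular $\mathcal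 H$ generates $\mathrm{Syz}(f_1,\dots,f_m)$. -/

import Mathlib

namespace SigGB

noncomputable section

/-- A monic module monomial `x ^ exponent • e_index` of `R ^ m`, where `R = K[x_s : s ∈ σ]`. -/
@[ext]
structure ModMonomial (σ : Type*) (m : ℕ) where
  /-- the index of the unit vector -/
  index : Fin m
  /-- the exponent vector of the monomial in front of the unit vector -/
  exponent : σ →₀ ℕ

/-- Multiplication of a module monomial by the monomial `x ^ e`. -/
def ModMonomial.mul {σ : Type*} {m : ℕ} (e : σ →₀ ℕ) (T : ModMonomial σ m) : ModMonomial σ m :=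
  ⟨T.index, e + T.exponent⟩

/-- A module monomial order on `R ^ m`: a well-order on the module monomials such that `S ≤ T`
implies `c S ≤ c T` for all monomials `c` of `R`. -/
structure ModMonomialOrder (σ : Type*) (m : ℕ) where
  /-- the underlying total order -/
  toLinearOrder : LinearOrder (ModMonomial σ m)
  wellFounded_lt : WellFounded toLinearOrder.lt
  mul_le_mul : ∀ (e : σ →₀ ℕ) (S T : ModMonomial σ m),
    toLinearOrder.le S T → toLinearOrder.le (S.mul e) (T.mul e)

/-- The module monomial order `mord` is a compatible extension of the monomial order `ord`:
`a ≤ b` if and only if `a e_i ≤ b e_i`, for all monomials `a`, `b` and all `i`. -/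
def Compatible {σ : Type*} {m : ℕ} (ord : MonomialOrder σ) (mord : ModMonomialOrder σ m) : Prop :=
  ∀ (a b : σ →₀ ℕ) (i : Fin m),
    ord.toSyn a ≤ ord.toSyn b ↔ mord.toLinearOrder.le ⟨i, a⟩ ⟨i, b⟩

/-- The free module `R ^ m` over `R = K[x_s : s ∈ σ]`. -/
abbrev FreeMod (σ K : Type*) [Field K] (m : ℕ) : Type _ := Fin m → MvPolynomial σ K

/-- The `i`-th unit vector. -/
def unitVec {σ K : Type*} [Field K] {m : ℕ} (i : Fin m) : FreeMod σ K m := Pi.single i 1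

/-- The homomorphism `R ^ m → R`, `(a_1, …, a_m) ↦ a_1 f_1 + … + a_m f_m`. -/
def proj {σ K : Type*} [Field K] {m : ℕ} (f : Fin m → MvPolynomial σ K) :
    FreeMod σ K m →ₗ[MvPolynomial σ K] MvPolynomial σ K :=
  Fintype.linearCombination (MvPolynomial σ K) f

/-- The module of syzygies of `f_1, …, f_m`. -/
def syz {σ K : Type*} [Field K] {m : ℕ} (f : Fin m → MvPolynomial σ K) :
    Submodule (MvPolynomial σ K) (FreeMod σ K m) :=
  LinearMap.ker (proj f)

/-- The coefficient of the module monomial `T` in `α`. -/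
def modCoeff {σ K : Type*} [Field K] {m : ℕ} (T : ModMonomial σ m) (α : FreeMod σ K m) : K :=
  (α T.index).coeff T.exponent

open Classical in
/-- The finite set of module monomials that occur in `α`. -/
def modSupport {σ K : Type*} [Field K] {m : ℕ} (α : FreeMod σ K m) : Finset (ModMonomial σ m) :=
  Finset.univ.biUnion fun i => (α i).support.image fun e => ⟨i, e⟩

theorem mem_modSupport {σ K : Type*} [Field K] {m : ℕ} (α : FreeMod σ K m)
    (T : ModMonomial σ m) : T ∈ modSupport α ↔ modCoeff T α ≠ 0 := by
  classical
  obtain ⟨i, e⟩ := T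
  simp [modSupport, modCoeff]

/-- The signature of `α`, up to a non-zero scalar: the largest module monomial of `α`.
It is `⊥` for `α = 0`. Two non-zero elements have equal values of `sig` exactly if their
signatures agree up to a non-zero scalar. -/
def sig {σ K : Type*} [Field K] {m : ℕ} (mord : ModMonomialOrder σ m) (α : FreeMod σ K m) :
    WithBot (ModMonomial σ m) :=
  letI := mord.toLinearOrder
  (modSupport α).max

/-- Comparison of signatures, `⊥` being smallest. -/
def sigLE {σ : Type*} {m : ℕ} (mord : ModMonomialOrder σ m)
    (S T : WithBot (ModMonomial σ m)) : Prop :=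
  letI := mord.toLinearOrder
  S ≤ T

/-- `b β`, where `b = c x ^ e`, s-reduces the term with exponent `d` of the image of `α`:
this is a term `t` of the image, the lead term (with its coefficient) of the image of `b β` is `t`,
and the signature of `b β` is at most that of `α`. -/
def SReducesTerm {σ K : Type*} [Field K] {m : ℕ} (ord : MonomialOrder σ)
    (mord : ModMonomialOrder σ m) (f : Fin m → MvPolynomial σ K)
    (α : FreeMod σ K m) (d e : σ →₀ ℕ) (c : K) (β : FreeMod σ K m) : Prop :=
  d ∈ (proj f α).support ∧ c ≠ 0 ∧
  ord.leadingTerm (proj f (MvPolynomial.monomial e c • β)) =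
    MvPolynomial.monomial d ((proj f α).coeff d) ∧
  sigLE mord (sig mord (MvPolynomial.monomial e c • β)) (sig mord α)

/-- One s-reduction step, of any term, with an s-reducer from `G`. -/
def SStep {σ K : Type*} [Field K] {m : ℕ} (ord : MonomialOrder σ)
    (mord : ModMonomialOrder σ m) (f : Fin m → MvPolynomial σ K)
    (G : Finset (FreeMod σ K m)) (α α' : FreeMod σ K m) : Prop :=
  ∃ β ∈ G, ∃ (d e : σ →₀ ℕ) (c : K), SReducesTerm ord mord f α d e c β ∧
    α' = α - MvPolynomial.monomial e c • β

/-- One regular s-reduction step, of any term (top or tail), with an s-reducer from `G`. -/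
def RegularSStep {σ K : Type*} [Field K] {m : ℕ} (ord : MonomialOrder σ)
    (mord : ModMonomialOrder σ m) (f : Fin m → MvPolynomial σ K)
    (G : Finset (FreeMod σ K m)) (α α' : FreeMod σ K m) : Prop :=
  ∃ β ∈ G, ∃ (d e : σ →₀ ℕ) (c : K), SReducesTerm ord mord f α d e c β ∧
    sig mord (MvPolynomial.monomial e c • β) ≠ sig mord α ∧
    α' = α - MvPolynomial.monomial e c • β

/-- `α` can be singular top s-reduced by some element of `G`. -/
def SingularTopReducible {σ K : Type*} [Field K] {m : ℕ} (ord : MonomialOrder σ)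
    (mord : ModMonomialOrder σ m) (f : Fin m → MvPolynomial σ K)
    (G : Finset (FreeMod σ K m)) (α : FreeMod σ K m) : Prop :=
  ∃ β ∈ G, ∃ (e : σ →₀ ℕ) (c : K),
    SReducesTerm ord mord f α (ord.degree (proj f α)) e c β ∧
    sig mord (MvPolynomial.monomial e c • β) = sig mord α

/-- `α` s-reduces to zero with respect to `G`: some sequence of s-reduction steps leads to a
syzygy. (A syzygy cannot be s-reduced any further.) -/
def SReducesToZero {σ K : Type*} [Field K] {m : ℕ} (ord : MonomialOrder σ)
    (mord : ModMonomialOrder σ m) (f : Fin m → MvPolynomial σ K)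
    (G : Finset (FreeMod σ K m)) (α : FreeMod σ K m) : Prop :=
  ∃ γ, Relation.ReflTransGen (SStep ord mord f G) α γ ∧ proj f γ = 0

/-- `G` is a signature Gröbner basis in signature `T`. -/
def IsSigGBIn {σ K : Type*} [Field K] {m : ℕ} (ord : MonomialOrder σ)
    (mord : ModMonomialOrder σ m) (f : Fin m → MvPolynomial σ K)
    (G : Finset (FreeMod σ K m)) (T : ModMonomial σ m) : Prop :=
  ∀ α : FreeMod σ K m, sig mord α = T → SReducesToZero ord mord f G α

/-- `G` is a signature Gröbner basis, that is, one in all signatures. -/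
def IsSigGB {σ K : Type*} [Field K] {m : ℕ} (ord : MonomialOrder σ)
    (mord : ModMonomialOrder σ m) (f : Fin m → MvPolynomial σ K)
    (G : Finset (FreeMod σ K m)) : Prop :=
  ∀ T : ModMonomial σ m, IsSigGBIn ord mord f G T

/-- One step of the usual reduction in `R ^ m` with a reducer from `H`: a term of `α`, at the
module monomial `T`, is cancelled by the equal lead term of `b η`, where `η ∈ H`, `b = c x ^ e`. -/
def ModStep {σ K : Type*} [Field K] {m : ℕ} (mord : ModMonomialOrder σ m)
    (H : Finset (FreeMod σ K m)) (α α' : FreeMod σ K m) : Prop :=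
  ∃ η ∈ H, ∃ (T : ModMonomial σ m) (e : σ →₀ ℕ) (c : K),
    modCoeff T α ≠ 0 ∧
    sig mord (MvPolynomial.monomial e c • η) = T ∧
    modCoeff T (MvPolynomial.monomial e c • η) = modCoeff T α ∧
    α' = α - MvPolynomial.monomial e c • η

/-- `H` is a Gröbner basis of the submodule `N` of `R ^ m`: it is a finite subset of `N`, and all
elements of `N` reduce to zero with respect to `H`. -/
def IsModuleGB {σ K : Type*} [Field K] {m : ℕ} (mord : ModMonomialOrder σ m)
    (N : Submodule (MvPolynomial σ K) (FreeMod σ K m)) (H : Finset (FreeMod σ K m)) : Prop :=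
  (∀ η ∈ H, η ∈ N) ∧ ∀ α ∈ N, Relation.ReflTransGen (ModStep mord H) α 0

/-- The multiple `(lcm / lead term) • α` of `α` in the S-pair of `α` and `β`, where `lcm` is the
monic least common multiple of the lead terms of their images. -/
def spairPart {σ K : Type*} [Field K] {m : ℕ} (ord : MonomialOrder σ)
    (f : Fin m → MvPolynomial σ K) (α β : FreeMod σ K m) : FreeMod σ K m :=
  MvPolynomial.monomial
    (ord.degree (proj f α) ⊔ ord.degree (proj f β) - ord.degree (proj f α))
    (ord.leadingCoeff (proj f α))⁻¹ • α

/-- The S-pair of `α` and `β` (used only if neither is a syzygy). -/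
def spair {σ K : Type*} [Field K] {m : ℕ} (ord : MonomialOrder σ)
    (f : Fin m → MvPolynomial σ K) (α β : FreeMod σ K m) : FreeMod σ K m :=
  spairPart ord f α β - spairPart ord f β α

/-- The S-pair of `α` and `β` is regular. -/
def SPairRegular {σ K : Type*} [Field K] {m : ℕ} (ord : MonomialOrder σ)
    (mord : ModMonomialOrder σ m) (f : Fin m → MvPolynomial σ K) (α β : FreeMod σ K m) : Prop :=
  sig mord (spairPart ord f α β) ≠ sig mord (spairPart ord f β α)

/-- A state of the algorithm: the sets `𝓖`, `𝓗`, `𝓟`, and the element that is being regular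
s-reduced, or `none` at the head of the while loop. -/
structure State (σ K : Type*) [Field K] (m : ℕ) where
  /-- the basis `𝓖` -/
  basis : Finset (FreeMod σ K m)
  /-- the syzygies `𝓗` -/
  syzygies : Finset (FreeMod σ K m)
  /-- the pair set `𝓟` -/
  pairs : Finset (FreeMod σ K m)
  /-- the element under reduction -/
  current : Option (FreeMod σ K m)

open Classical in
/-- The initial state: `𝓖 = 𝓗 = ∅` and `𝓟 = {e_1, …, e_m}`. -/
def State.init (σ K : Type*) [Field K] (m : ℕ) : State σ K m :=
  ⟨∅, ∅, Finset.univ.image unitVec, none⟩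

/-- The loop condition fails at the head of the loop: the algorithm returns `(𝓖, 𝓗)`. -/
def State.Halted {σ K : Type*} [Field K] {m : ℕ} (s : State σ K m) : Prop :=
  s.current = none ∧ s.pairs = ∅

open Classical in
/-- One elementary step of `genSB`, `prec` being the order on the pair set. The choice of the
regular s-reducers and of the terms that they reduce is left open. -/
inductive Step {σ K : Type*} [Field K] {m : ℕ} (ord : MonomialOrder σ)
    (mord : ModMonomialOrder σ m) (prec : LinearOrder (FreeMod σ K m))
    (f : Fin m → MvPolynomial σ K) : State σ K m → State σ K m → Prop
  /-- choose `β = min 𝓟` and remove it from `𝓟` -/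
  | select (G H P : Finset (FreeMod σ K m)) (β : FreeMod σ K m) (mem : β ∈ P)
      (min : ∀ β' ∈ P, prec.le β β') :
      Step ord mord prec f ⟨G, H, P, none⟩ ⟨G, H, P.erase β, some β⟩
  /-- perform one regular s-reduction step -/
  | reduce (G H P : Finset (FreeMod σ K m)) (γ γ' : FreeMod σ K m)
      (red : RegularSStep ord mord f G γ γ') :
      Step ord mord prec f ⟨G, H, P, some γ⟩ ⟨G, H, P, some γ'⟩
  /-- the result of the regular s-reduction is a syzygy: add it to `𝓗` -/
  | addSyzygy (G H P : Finset (FreeMod σ K m)) (γ : FreeMod σ K m)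
      (irred : ∀ γ', ¬ RegularSStep ord mord f G γ γ') (zero : proj f γ = 0) :
      Step ord mord prec f ⟨G, H, P, some γ⟩ ⟨G, insert γ H, P, none⟩
  /-- the result is no syzygy, but singular top s-reducible: discard it -/
  | discard (G H P : Finset (FreeMod σ K m)) (γ : FreeMod σ K m)
      (irred : ∀ γ', ¬ RegularSStep ord mord f G γ γ') (nonzero : proj f γ ≠ 0)
      (sing : SingularTopReducible ord mord f G γ) :
      Step ord mord prec f ⟨G, H, P, some γ⟩ ⟨G, H, P, none⟩
  /-- otherwise add the regular S-pairs with the elements of `𝓖` to `𝓟`, and the result to `𝓖` -/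
  | addBasis (G H P : Finset (FreeMod σ K m)) (γ : FreeMod σ K m)
      (irred : ∀ γ', ¬ RegularSStep ord mord f G γ γ') (nonzero : proj f γ ≠ 0)
      (nonsing : ¬ SingularTopReducible ord mord f G γ) :
      Step ord mord prec f ⟨G, H, P, some γ⟩
        ⟨insert γ G, H,
          P ∪ (G.filter fun α => SPairRegular ord mord f α γ).image fun α => spair ord f α γ,
          none⟩

/-- `s` is a state of some run of `genSB` on the input `f`. -/
def Reachable {σ K : Type*} [Field K] {m : ℕ} (ord : MonomialOrder σ)
    (mord : ModMonomialOrder σ m) (prec : LinearOrder (FreeMod σ K m))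
    (f : Fin m → MvPolynomial σ K) (s : State σ K m) : Prop :=
  Relation.ReflTransGen (Step ord mord prec f) (State.init σ K m) s

end

end SigGB

namespace SigGB

/-! Correctness rests on a cover criterion. Call a signature `S` covered below `D` if `H` contains
an element of signature `S`, or a multiple of an element of `G` has signature `S` and lead monomial
below `D`. Every run keeps the signature of each unit vector (below `⊤`) and of each regular S-pair
(below the lcm) covered or awaiting processing (`Pending.step`, `AllPending.step`). When the
algorithm halts, nothing is awaiting, so all are covered.

Given this, fix `T` not divisible by a signature from `H`, and take a multiple of an element of `G`
with signature `T` and least lead monomial. A regular top reducer of it would yield a regular S-pair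
whose signature divides `T`, and the cover of that pair would give a smaller lead monomial. So the
minimal multiple is not regular top reducible (`AllCovered.dichotomy`). Subtracting such a multiple,
or one of an element of `H`, lowers the signature. Induction on signatures then shows that every
non-syzygy is top reducible and that every signature of a syzygy is divisible by one from `H`.

For termination, compare elements by the ratio of signature to lead monomial. A regular S-pair has
larger ratio than its two constituents, and regular reduction never lowers the ratio. Label a pair
by the signatures and lead monomials of successive ancestors, following the newer parent. If
ancestor data divided those of a fully reduced non-syzygy, the growth of the ratio would make the
ancestor a regular top reducer (`IsAncestry.not_dataDvd`). Hence labels are bad sequences in the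
sense of Dickson's lemma. Processing an element replaces its label by finitely many proper
extensions, which is well-founded on multisets; a single reduction stops because its terms decrease.
-/

theorem ModMonomial.mul_zero {σ : Type*} {m : ℕ} (T : ModMonomial σ m) : T.mul 0 = T := by
  ext <;> simp [ModMonomial.mul]

theorem ModMonomial.mul_mul {σ : Type*} {m : ℕ} (a b : σ →₀ ℕ) (T : ModMonomial σ m) :
    (T.mul b).mul a = T.mul (a + b) := by
  ext <;> simp [ModMonomial.mul, add_assoc]

theorem ModMonomial.mul_injective {σ : Type*} {m : ℕ} (e : σ →₀ ℕ) :
    Function.Injective (ModMonomial.mul (m := m) e) := by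
  intro S T h
  simp only [ModMonomial.mul, ModMonomial.mk.injEq, add_right_inj] at h
  exact ModMonomial.ext h.1 h.2

/-! ### Multiplication and cancellation in the module monomial order -/

section Order

variable {σ : Type*} {m : ℕ} {mord : ModMonomialOrder σ m}

theorem mul_lt_mul_mod (e : σ →₀ ℕ) {S T : ModMonomial σ m} (h : mord.toLinearOrder.lt S T) :
    mord.toLinearOrder.lt (S.mul e) (T.mul e) := by
  let := mord.toLinearOrder
  exact lt_of_le_of_ne (mord.mul_le_mul e S T (le_of_lt h))
    fun h' => (ne_of_lt h) (ModMonomial.mul_injective e h')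

theorem mul_lt_mul_mod_iff (e : σ →₀ ℕ) {S T : ModMonomial σ m} :
    mord.toLinearOrder.lt (S.mul e) (T.mul e) ↔ mord.toLinearOrder.lt S T := by
  let := mord.toLinearOrder
  refine ⟨fun h => ?_, mul_lt_mul_mod e⟩
  by_contra h'
  exact absurd h (not_lt_of_ge (mord.mul_le_mul e T S (not_lt.mp h')))

/-- This allows ratios of a signature and a lead monomial to be compared by cross-multiplication. -/
theorem Compatible.mul_lt_mul_iff {ord : MonomialOrder σ} (h : Compatible ord mord)
    {a b : σ →₀ ℕ} {T : ModMonomial σ m} :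
    mord.toLinearOrder.lt (T.mul a) (T.mul b) ↔ ord.toSyn a < ord.toSyn b := by
  let := mord.toLinearOrder
  have := h (b + T.exponent) (a + T.exponent) T.index
  rw [map_add, map_add, add_le_add_iff_right] at this
  exact (lt_iff_not_ge (a := T.mul a) (b := T.mul b)).trans
    ((not_congr this.symm).trans not_le)

end Order

/-! ### Signatures of multiples and differences -/

section Signature

variable {σ K : Type*} [Field K] {m : ℕ} {mord : ModMonomialOrder σ m}

theorem modCoeff_sub (T : ModMonomial σ m) (α β : FreeMod σ K m) :
    modCoeff T (α - β) = modCoeff T α - modCoeff T β := by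
  simp [modCoeff]

theorem modCoeff_mul_monomial_smul (T : ModMonomial σ m) (e : σ →₀ ℕ) (c : K)
    (α : FreeMod σ K m) :
    modCoeff (T.mul e) (MvPolynomial.monomial e c • α) = c * modCoeff T α := by
  simp [modCoeff, ModMonomial.mul, MvPolynomial.coeff_monomial_mul]

theorem exists_of_modCoeff_monomial_smul_ne_zero {S : ModMonomial σ m} {e : σ →₀ ℕ} {c : K}
    {α : FreeMod σ K m} (h : modCoeff S (MvPolynomial.monomial e c • α) ≠ 0) :
    ∃ T : ModMonomial σ m, T.mul e = S ∧ modCoeff T α ≠ 0 := by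
  classical
  simp only [modCoeff, Pi.smul_apply, smul_eq_mul, MvPolynomial.coeff_monomial_mul'] at h
  split_ifs at h with he
  · refine ⟨⟨S.index, S.exponent - e⟩, ?_, right_ne_zero_of_mul h⟩
    ext1
    · rfl
    · exact add_tsub_cancel_of_le he
  · exact absurd rfl h

theorem eq_zero_iff_modCoeff {α : FreeMod σ K m} :
    α = 0 ↔ ∀ T : ModMonomial σ m, modCoeff T α = 0 := by
  refine ⟨fun h T => by simp [h, modCoeff], fun h => ?_⟩
  funext i
  ext e
  exact h ⟨i, e⟩

theorem sig_eq_coe_iff {α : FreeMod σ K m} {T : ModMonomial σ m} :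
    sig mord α = T ↔
      modCoeff T α ≠ 0 ∧ ∀ S, modCoeff S α ≠ 0 → mord.toLinearOrder.le S T := by
  let := mord.toLinearOrder
  simp only [← mem_modSupport]
  constructor
  · intro h
    exact ⟨Finset.mem_of_max h, fun S hS => Finset.le_max_of_eq hS h⟩
  · rintro ⟨h1, h2⟩
    refine le_antisymm (Finset.max_le fun S hS => WithBot.coe_le_coe.mpr (h2 S hS)) ?_
    exact Finset.le_max h1

theorem exists_sig_eq {α : FreeMod σ K m} (h : α ≠ 0) :
    ∃ T : ModMonomial σ m, sig mord α = T := by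
  let := mord.toLinearOrder
  obtain ⟨T, hT⟩ := not_forall.mp (mt eq_zero_iff_modCoeff.mpr h)
  obtain ⟨S, hS⟩ := Finset.max_of_mem ((mem_modSupport α T).mpr hT)
  exact ⟨S, hS⟩

theorem sigLE_coe {S T : ModMonomial σ m} :
    sigLE mord (S : WithBot (ModMonomial σ m)) T ↔ mord.toLinearOrder.le S T := by
  let := mord.toLinearOrder
  exact WithBot.coe_le_coe

theorem sig_monomial_smul {α : FreeMod σ K m} {T : ModMonomial σ m} (h : sig mord α = T)
    (e : σ →₀ ℕ) {c : K} (hc : c ≠ 0) :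
    sig mord (MvPolynomial.monomial e c • α) = T.mul e := by
  rw [sig_eq_coe_iff] at h ⊢
  rw [modCoeff_mul_monomial_smul]
  refine ⟨mul_ne_zero hc h.1, fun S hS => ?_⟩
  obtain ⟨S, rfl, hS'⟩ := exists_of_modCoeff_monomial_smul_ne_zero hS
  exact mord.mul_le_mul _ _ _ (h.2 S hS')

theorem sig_sub_eq_left {α β : FreeMod σ K m} {S T : ModMonomial σ m} (hα : sig mord α = T)
    (hβ : sig mord β = S) (h : mord.toLinearOrder.lt S T) : sig mord (α - β) = T := by
  let := mord.toLinearOrder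
  rw [sig_eq_coe_iff] at hα hβ ⊢
  have h0 : modCoeff T β = 0 := by
    by_contra h'
    exact absurd h (not_lt_of_ge (hβ.2 T h'))
  refine ⟨by rw [modCoeff_sub, h0, sub_zero]; exact hα.1, fun U hU => ?_⟩
  rw [modCoeff_sub] at hU
  by_cases hU' : modCoeff U α = 0
  · refine le_trans (hβ.2 U ?_) (le_of_lt h)
    intro h'
    simp [hU', h'] at hU
  · exact hα.2 U hU'

theorem sig_neg (α : FreeMod σ K m) : sig mord (-α) = sig mord α := by
  have : modSupport (-α) = modSupport α := by
    ext T
    simp [mem_modSupport, modCoeff]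
  simp only [sig, this]

/-- If two vectors have the same leading monomial and coefficient, their difference is zero or
has a smaller signature. -/
theorem sig_sub_lt {α β : FreeMod σ K m} {S T : ModMonomial σ m} (hα : sig mord α = T)
    (hβ : sig mord β = T) (hc : modCoeff T α = modCoeff T β) (h : sig mord (α - β) = S) :
    mord.toLinearOrder.lt S T := by
  let := mord.toLinearOrder
  rw [sig_eq_coe_iff] at hα hβ h
  have hS := h.1
  rw [modCoeff_sub] at hS
  refine lt_of_le_of_ne ?_ ?_
  · by_cases hS' : modCoeff S α = 0
    · refine hβ.2 S ?_
      intro h'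
      simp [hS', h'] at hS
    · exact hα.2 S hS'
  · rintro rfl
    exact hS (sub_eq_zero.mpr hc)

/-- A multiple of `β` with the leading monomial of `α` can be scaled to cancel it. -/
theorem exists_modCoeff_monomial_smul_eq {α β : FreeMod σ K m} {T U : ModMonomial σ m}
    {e : σ →₀ ℕ} (hα : sig mord α = T) (hβ : sig mord β = U) (he : U.mul e = T) :
    ∃ c : K, c ≠ 0 ∧ sig mord (MvPolynomial.monomial e c • β) = T ∧
      modCoeff T (MvPolynomial.monomial e c • β) = modCoeff T α := by
  have h1 := (sig_eq_coe_iff.mp hα).1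
  have h2 := (sig_eq_coe_iff.mp hβ).1
  have hc : modCoeff T α / modCoeff U β ≠ 0 := div_ne_zero h1 h2
  refine ⟨modCoeff T α / modCoeff U β, hc, (sig_monomial_smul hβ e hc).trans (congrArg _ he), ?_⟩
  nth_rw 1 [← he]
  rw [modCoeff_mul_monomial_smul, div_mul_cancel₀ _ h2]

end Signature

/-! ### Lead terms and cancellation in the polynomial ring -/

section Degree

variable {σ K : Type*} [Field K] {ord : MonomialOrder σ}

theorem le_degree_of_coeff_ne_zero {p : MvPolynomial σ K} {x : σ →₀ ℕ} (h : p.coeff x ≠ 0) :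
    ord.toSyn x ≤ ord.toSyn (ord.degree p) :=
  ord.le_degree (MvPolynomial.mem_support_iff.mpr h)

theorem degree_leadingCoeff_of_leadingTerm_eq {p : MvPolynomial σ K} {d : σ →₀ ℕ} {c : K}
    (hc : c ≠ 0) (h : ord.leadingTerm p = MvPolynomial.monomial d c) :
    ord.degree p = d ∧ ord.leadingCoeff p = c := by
  classical
  have h1 := congrArg ord.degree h
  have h2 := congrArg ord.leadingCoeff h
  rw [ord.degree_leadingTerm, ord.degree_monomial, if_neg hc] at h1
  rw [ord.leadingCoeff_leadingTerm, ord.leadingCoeff_monomial] at h2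
  exact ⟨h1, h2⟩

theorem degree_leadingCoeff_monomial_mul {p : MvPolynomial σ K} (hp : p ≠ 0) (e : σ →₀ ℕ)
    {c : K} (hc : c ≠ 0) :
    ord.degree (MvPolynomial.monomial e c * p) = e + ord.degree p ∧
      ord.leadingCoeff (MvPolynomial.monomial e c * p) = c * ord.leadingCoeff p := by
  classical
  have hm : MvPolynomial.monomial e c ≠ 0 := by simpa using hc
  refine ⟨by rw [ord.degree_mul hm hp, ord.degree_monomial, if_neg hc], ?_⟩
  rw [ord.leadingCoeff_mul_of_mul_leadingCoeff_ne_zero, ord.leadingCoeff_monomial]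
  exact mul_ne_zero (ord.leadingCoeff_ne_zero_iff.mpr hm) (ord.leadingCoeff_ne_zero_iff.mpr hp)

/-- Subtracting a polynomial whose lead term is a term of `p` cancels this term, and leaves the
larger ones alone. -/
theorem coeff_sub_of_leadingTerm_eq {p q : MvPolynomial σ K} {d : σ →₀ ℕ} (hd : p.coeff d ≠ 0)
    (h : ord.leadingTerm q = MvPolynomial.monomial d (p.coeff d)) :
    (p - q).coeff d = 0 ∧ ∀ x, ord.toSyn d < ord.toSyn x → (p - q).coeff x = p.coeff x := by
  obtain ⟨h1, h2⟩ := degree_leadingCoeff_of_leadingTerm_eq hd h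
  constructor
  · rw [MvPolynomial.coeff_sub, sub_eq_zero, ← h2, MonomialOrder.leadingCoeff, h1]
  · intro x hx
    subst h1
    rw [MvPolynomial.coeff_sub, ord.coeff_eq_zero_of_lt hx, sub_zero]

theorem degree_sub_lt_of_leadingTerm_eq {p q : MvPolynomial σ K} (hp : p ≠ 0)
    (h : ord.leadingTerm q = ord.leadingTerm p) (hpq : p - q ≠ 0) :
    ord.toSyn (ord.degree (p - q)) < ord.toSyn (ord.degree p) := by
  have hd := ord.coeff_degree_ne_zero_iff.mpr hp
  obtain ⟨h1, h2⟩ := coeff_sub_of_leadingTerm_eq hd h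
  have h3 := ord.coeff_degree_ne_zero_iff.mpr hpq
  by_contra h4
  rcases lt_or_eq_of_le (not_lt.mp h4) with h5 | h5
  · rw [h2 _ h5] at h3
    exact absurd (le_degree_of_coeff_ne_zero h3) (not_le_of_gt h5)
  · rw [← ord.toSyn.injective h5] at h3
    exact h3 h1

theorem degree_sub_le_of_leadingTerm_eq {p q : MvPolynomial σ K} {d : σ →₀ ℕ}
    (hd : p.coeff d ≠ 0) (h : ord.leadingTerm q = MvPolynomial.monomial d (p.coeff d)) :
    ord.toSyn (ord.degree (p - q)) ≤ ord.toSyn (ord.degree p) := by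
  obtain ⟨-, h2⟩ := coeff_sub_of_leadingTerm_eq hd h
  refine ord.degree_le_iff.mpr fun x hx => ?_
  by_contra h4
  rw [MvPolynomial.mem_support_iff,
    h2 _ (lt_of_le_of_lt (le_degree_of_coeff_ne_zero hd) (not_le.mp h4))] at hx
  exact h4 (le_degree_of_coeff_ne_zero hx)

/-- The terms of a polynomial form a set that gets smaller when its largest changed term is
cancelled. -/
def TermsLT (ord : MonomialOrder σ) (p q : MvPolynomial σ K) : Prop :=
  ∃ d, (∀ x, ord.toSyn d < ord.toSyn x → p.coeff x = q.coeff x) ∧ p.coeff d = 0 ∧ q.coeff d ≠ 0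

theorem wellFounded_termsLT (ord : MonomialOrder σ) :
    WellFounded (TermsLT ord : MvPolynomial σ K → MvPolynomial σ K → Prop) := by
  -- `r` reverses the monomial order so that the lexicographic comparison looks at the largest
  -- exponents first; `s` only distinguishes zero from non-zero coefficients.
  let r : (σ →₀ ℕ) → (σ →₀ ℕ) → Prop := fun a b => ord.toSyn b < ord.toSyn a
  let s : K → K → Prop := fun a b => a = 0 ∧ b ≠ 0
  have hr : WellFounded (Function.swap r) := InvImage.wf ord.toSyn (wellFounded_lt (α := ord.syn))
  have hs : WellFounded s := by
    have h0 : Acc s (0 : K) := ⟨_, fun y hy => absurd rfl hy.2⟩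
    exact ⟨fun a => ⟨_, fun y hy => hy.1 ▸ h0⟩⟩
  have : Std.Trichotomous r := ⟨fun a b h1 h2 =>
    ord.toSyn.injective (le_antisymm (not_lt.mp h1) (not_lt.mp h2))⟩
  have := Finsupp.Lex.wellFounded' (r := r) (s := s) (fun n h => h.2 rfl) hs hr
  exact InvImage.wf AddMonoidAlgebra.coeff this

end Degree

/-! ### The cover criterion and its consequences -/

section Correctness

variable {σ K : Type*} [Field K] {m : ℕ} {ord : MonomialOrder σ} {mord : ModMonomialOrder σ m}
  {f : Fin m → MvPolynomial σ K}

/-- `α` is no syzygy, has signature `U`, and its image has a lead term with exponent `d`. -/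
structure IsLead (ord : MonomialOrder σ) (mord : ModMonomialOrder σ m)
    (f : Fin m → MvPolynomial σ K) (α : FreeMod σ K m) (U : ModMonomial σ m) (d : σ →₀ ℕ) :
    Prop where
  proj_ne_zero : proj f α ≠ 0
  sig_eq : sig mord α = U
  degree_eq : ord.degree (proj f α) = d

theorem exists_isLead {α : FreeMod σ K m} (h : proj f α ≠ 0) :
    ∃ U, IsLead ord mord f α U (ord.degree (proj f α)) := by
  obtain ⟨U, hU⟩ := exists_sig_eq (mord := mord) (α := α) (by rintro rfl; simp at h)
  exact ⟨U, h, hU, rfl⟩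

theorem IsLead.monomial_smul {α : FreeMod σ K m} {U : ModMonomial σ m} {d : σ →₀ ℕ}
    (h : IsLead ord mord f α U d) (e : σ →₀ ℕ) {c : K} (hc : c ≠ 0) :
    IsLead ord mord f (MvPolynomial.monomial e c • α) (U.mul e) (e + d) := by
  refine ⟨?_, sig_monomial_smul h.sig_eq e hc, ?_⟩
  · rw [map_smul, smul_eq_mul]
    exact mul_ne_zero (by simpa using hc) h.proj_ne_zero
  · rw [map_smul, smul_eq_mul, (degree_leadingCoeff_monomial_mul h.proj_ne_zero e hc).1,
      h.degree_eq]

/-- A multiple of `β` with the lead monomial of the image of `α` can be scaled to have the same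
lead term. -/
theorem IsLead.exists_leadingTerm_eq {α β : FreeMod σ K m} {U : ModMonomial σ m}
    {d e : σ →₀ ℕ} (h : IsLead ord mord f β U d) (hα : proj f α ≠ 0)
    (he : e + d = ord.degree (proj f α)) :
    ∃ c : K, c ≠ 0 ∧ ord.leadingTerm (proj f (MvPolynomial.monomial e c • β)) =
      ord.leadingTerm (proj f α) := by
  have h1 := ord.leadingCoeff_ne_zero_iff.mpr hα
  have h2 := ord.leadingCoeff_ne_zero_iff.mpr h.proj_ne_zero
  have hc := div_ne_zero h1 h2
  refine ⟨_, hc, ?_⟩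
  obtain ⟨h3, h4⟩ := degree_leadingCoeff_monomial_mul (ord := ord) h.proj_ne_zero e hc
  rw [map_smul, smul_eq_mul, MonomialOrder.leadingTerm, h3, h4, h.degree_eq, he,
    div_mul_cancel₀ _ h2]
  rfl

/-- Top reducibility depends only on lead monomials and signatures: over a field the scalar can
always be adjusted. -/
theorem IsLead.exists_sReducesTerm {α β : FreeMod σ K m} {U T : ModMonomial σ m}
    {d e : σ →₀ ℕ} (h : IsLead ord mord f β U d) (hα : proj f α ≠ 0) (hT : sig mord α = T)
    (he : e + d = ord.degree (proj f α)) (hle : mord.toLinearOrder.le (U.mul e) T) :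
    ∃ c : K, SReducesTerm ord mord f α (ord.degree (proj f α)) e c β ∧
      sig mord (MvPolynomial.monomial e c • β) = U.mul e := by
  obtain ⟨c, hc, hl⟩ := h.exists_leadingTerm_eq hα he
  have hs := sig_monomial_smul h.sig_eq e hc
  refine ⟨c, ⟨ord.degree_mem_support hα, hc, hl, ?_⟩, hs⟩
  rw [hs, hT, sigLE_coe]
  exact hle

theorem SReducesTerm.exists_isLead {α β : FreeMod σ K m} {d e : σ →₀ ℕ} {c : K}
    (h : SReducesTerm ord mord f α d e c β) :
    ∃ U d', IsLead ord mord f β U d' ∧ e + d' = d ∧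
      sig mord (MvPolynomial.monomial e c • β) = U.mul e := by
  obtain ⟨hd, hc, hl, -⟩ := h
  rw [MvPolynomial.mem_support_iff] at hd
  have hβ : proj f β ≠ 0 := by
    intro h0
    rw [map_smul, h0, smul_zero, ord.leadingTerm_zero, eq_comm,
      MvPolynomial.monomial_eq_zero] at hl
    exact hd hl
  obtain ⟨U, hU⟩ := SigGB.exists_isLead (ord := ord) (mord := mord) hβ
  refine ⟨U, _, hU, ?_, sig_monomial_smul hU.sig_eq e hc⟩
  rw [← (degree_leadingCoeff_of_leadingTerm_eq hd hl).1, (hU.monomial_smul e hc).degree_eq]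

variable (ord mord f) in
/-- An element of `H` has signature `S`, or else a multiple of an element of `G` has signature `S`
and a lead monomial below `D`. -/
def Covered (G H : Finset (FreeMod σ K m)) (S : ModMonomial σ m) (D : WithTop ord.syn) : Prop :=
  (∃ h ∈ H, sig mord h = S) ∨
    ∃ δ ∈ G, ∃ U d e, IsLead ord mord f δ U d ∧ U.mul e = S ∧
      (ord.toSyn (e + d) : WithTop ord.syn) < D

variable (ord mord f) in
/-- All unit vectors and all regular S-pairs are covered. -/
structure AllCovered (G H : Finset (FreeMod σ K m)) : Prop where
  syz : ∀ h ∈ H, proj f h = 0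
  unit : ∀ i, Covered ord mord f G H ⟨i, 0⟩ ⊤
  pair : ∀ α ∈ G, ∀ β ∈ G, ∀ U d V d', IsLead ord mord f α U d → IsLead ord mord f β V d' →
    mord.toLinearOrder.lt (V.mul (d ⊔ d' - d')) (U.mul (d ⊔ d' - d)) →
    Covered ord mord f G H (U.mul (d ⊔ d' - d)) (ord.toSyn (d ⊔ d'))

variable {G H : Finset (FreeMod σ K m)}

/-- Every signature is divisible by that of an element of `H`, or is that of a multiple of an
element of `G` that is not regular top s-reducible. -/
theorem AllCovered.dichotomy (h : AllCovered ord mord f G H) (T : ModMonomial σ m) :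
    (∃ η ∈ H, ∃ U e, sig mord η = (U : ModMonomial σ m) ∧ U.mul e = T) ∨
    ∃ δ ∈ G, ∃ U d e, IsLead ord mord f δ U d ∧ U.mul e = T ∧
      ∀ δ' ∈ G, ∀ U' d' e', IsLead ord mord f δ' U' d' → e' + d' = e + d →
        ¬ mord.toLinearOrder.lt (U'.mul e') T := by
  by_cases hH : ∃ η ∈ H, ∃ U e, sig mord η = (U : ModMonomial σ m) ∧ U.mul e = T
  · exact Or.inl hH
  refine Or.inr ?_
  -- The lead monomials of all multiples of elements of `G` in signature `T`; the chosen multiple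
  -- attains the minimum.
  let P : Set ord.syn := {x | ∃ δ ∈ G, ∃ U d e, IsLead ord mord f δ U d ∧ U.mul e = T ∧
    ord.toSyn (e + d) = x}
  have covered : ∀ (S : ModMonomial σ m) (a : σ →₀ ℕ) (D : WithTop ord.syn), S.mul a = T →
      Covered ord mord f G H S D →
      ∃ x : σ →₀ ℕ, ord.toSyn (a + x) ∈ P ∧ (ord.toSyn x : WithTop ord.syn) < D := by
    rintro S a D hS (⟨η, hη, hs⟩ | ⟨δ, hδ, U, d, e, hl, rfl, hD⟩)
    · exact absurd ⟨η, hη, S, a, hs, hS⟩ hH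
    · refine ⟨e + d, ⟨δ, hδ, U, d, a + e, hl, ?_, by rw [add_assoc]⟩, hD⟩
      rw [← ModMonomial.mul_mul, hS]
  have hP : P.Nonempty := by
    obtain ⟨x, hx, -⟩ := covered ⟨T.index, 0⟩ T.exponent ⊤
      (by ext1 <;> simp [ModMonomial.mul]) (h.unit T.index)
    exact ⟨_, hx⟩
  obtain ⟨_, ⟨δ, hδ, U, d, e, hl, hT, rfl⟩, hmin⟩ :=
    (wellFounded_lt (α := ord.syn)).has_min P hP
  refine ⟨δ, hδ, U, d, e, hl, hT, fun δ' hδ' U' d' e' hl' hd hlt => ?_⟩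
  have hle : d ⊔ d' ≤ e + d := sup_le le_add_self (hd ▸ le_add_self)
  obtain ⟨a, ha⟩ := exists_add_of_le hle
  -- Here `a` is the cofactor of the lcm in the common lead monomial. It turns the two halves of the
  -- S-pair into the two given multiples.
  have key : ∀ (x y : σ →₀ ℕ), x ≤ d ⊔ d' → y + x = e + d → a + (d ⊔ d' - x) = y := by
    intro x y hx hy
    rw [← add_left_inj x, add_assoc, tsub_add_cancel_of_le hx, hy, ha, add_comm]
  have h1 : (U.mul (d ⊔ d' - d)).mul a = T := by
    rw [ModMonomial.mul_mul, key d e le_sup_left rfl, hT]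
  have h2 : (U'.mul (d ⊔ d' - d')).mul a = U'.mul e' := by
    rw [ModMonomial.mul_mul, key d' e' le_sup_right hd]
  rw [← h1, ← h2, mul_lt_mul_mod_iff] at hlt
  obtain ⟨x, hx, hlt'⟩ := covered _ a _ h1 (h.pair δ hδ δ' hδ' U d U' d' hl hl' hlt)
  refine hmin _ hx ?_
  rw [ha, add_comm a x, map_add, map_add]
  exact add_lt_add_left (WithTop.coe_lt_coe.mp hlt') _

/-- Subtracting a multiple of a vector `β` with the same signature lowers the signature. -/
theorem exists_sub_sig_lt {α β : FreeMod σ K m} {T U : ModMonomial σ m} {e : σ →₀ ℕ}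
    (hα : sig mord α = T) (hβ : sig mord β = U) (he : U.mul e = T) :
    ∃ c : K, c ≠ 0 ∧ ∀ S : ModMonomial σ m,
      sig mord (α - MvPolynomial.monomial e c • β) = S → mord.toLinearOrder.lt S T := by
  obtain ⟨c, hc, h1, h2⟩ := exists_modCoeff_monomial_smul_eq hα hβ he
  exact ⟨c, hc, fun S hS => sig_sub_lt hα h1 h2.symm hS⟩

/-- Every vector that is no syzygy is top s-reducible. -/
theorem AllCovered.top_reducible (h : AllCovered ord mord f G H) (T : ModMonomial σ m) :
    ∀ α : FreeMod σ K m, sig mord α = T → proj f α ≠ 0 →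
      ∃ δ ∈ G, ∃ U d e, IsLead ord mord f δ U d ∧ e + d = ord.degree (proj f α) ∧
        mord.toLinearOrder.le (U.mul e) T := by
  let := mord.toLinearOrder
  induction T using mord.wellFounded_lt.induction with
  | _ T ih =>
  intro α hα hne
  have ih' : ∀ ρ : FreeMod σ K m,
      (∀ S : ModMonomial σ m, sig mord ρ = S → mord.toLinearOrder.lt S T) → proj f ρ ≠ 0 →
      ∃ δ ∈ G, ∃ U d e, IsLead ord mord f δ U d ∧ e + d = ord.degree (proj f ρ) ∧
        mord.toLinearOrder.lt (U.mul e) T := by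
    intro ρ hρ hne'
    obtain ⟨S, hS⟩ := SigGB.exists_isLead (ord := ord) (mord := mord) hne'
    obtain ⟨δ, hδ, U, d, e, hl, he, hle⟩ := ih S (hρ S hS.sig_eq) ρ hS.sig_eq hne'
    exact ⟨δ, hδ, U, d, e, hl, he, lt_of_le_of_lt hle (hρ S hS.sig_eq)⟩
  rcases h.dichotomy T with ⟨η, hη, U, e, hs, hU⟩ | ⟨δ, hδ, U, d, e, hl, hU, hirr⟩
  · obtain ⟨c, -, hlt⟩ := exists_sub_sig_lt hα hs hU
    have hp : proj f (α - MvPolynomial.monomial e c • η) = proj f α := by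
      rw [map_sub, map_smul, h.syz η hη, smul_zero, sub_zero]
    obtain ⟨δ, hδ, U, d, e, hl, he, hle⟩ := ih' _ hlt (hp ▸ hne)
    exact ⟨δ, hδ, U, d, e, hl, hp ▸ he, le_of_lt hle⟩
  · by_contra hcon
    obtain ⟨c, hc, hlt⟩ := exists_sub_sig_lt hα hl.sig_eq hU
    have hl' := hl.monomial_smul e hc
    -- With equal lead monomials, `δ` itself would reduce `α`, by a singular step.
    have hne' : e + d ≠ ord.degree (proj f α) :=
      fun h' => hcon ⟨δ, hδ, U, d, e, hl, h', le_of_eq hU⟩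
    -- Distinct lead monomials cannot cancel, so one of them leads the difference.
    have hdeg : ord.degree (proj f (α - MvPolynomial.monomial e c • δ)) =
        ord.degree (proj f α) ∨
        ord.degree (proj f (α - MvPolynomial.monomial e c • δ)) = e + d := by
      have := ord.degree_add_of_ne (f := proj f α)
        (g := -proj f (MvPolynomial.monomial e c • δ))
        (by rw [ord.degree_neg, hl'.degree_eq]; exact hne'.symm)
      rw [← sub_eq_add_neg, ← map_sub, ord.degree_neg, hl'.degree_eq] at this
      rcases max_choice (ord.toSyn (ord.degree (proj f α))) (ord.toSyn (e + d)) with h' | h'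
      · exact Or.inl (ord.toSyn.injective (this.trans h'))
      · exact Or.inr (ord.toSyn.injective (this.trans h'))
    have hp : proj f (α - MvPolynomial.monomial e c • δ) ≠ 0 := by
      intro h0
      rw [map_sub, sub_eq_zero] at h0
      exact hne' (by rw [h0, hl'.degree_eq])
    obtain ⟨δ', hδ', U', d', e', hl'', he, hlt'⟩ := ih' _ hlt hp
    rcases hdeg with h' | h'
    · exact hcon ⟨δ', hδ', U', d', e', hl'', he.trans h', le_of_lt hlt'⟩
    -- The reducer of the difference has signature below `T`, so it would be a regular top reducer
    -- of the multiple of `δ`.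
    · exact hirr δ' hδ' U' d' e' hl'' (he.trans h') hlt'

/-- The signature of a syzygy is divisible by that of an element of `H`. -/
theorem AllCovered.exists_sig_dvd (h : AllCovered ord mord f G H) {α : FreeMod σ K m}
    {T : ModMonomial σ m} (hα : sig mord α = T) (h0 : proj f α = 0) :
    ∃ η ∈ H, ∃ U e, sig mord η = (U : ModMonomial σ m) ∧ U.mul e = T := by
  let := mord.toLinearOrder
  rcases h.dichotomy T with h' | ⟨δ, hδ, U, d, e, hl, hU, hirr⟩
  · exact h'
  exfalso
  obtain ⟨c, hc, hlt⟩ := exists_sub_sig_lt hα hl.sig_eq hU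
  have hl' := hl.monomial_smul e hc
  -- Up to sign, the difference has the image of the multiple of `δ` but a smaller signature, so any
  -- top reducer of it contradicts `hirr`.
  have hp : proj f (α - MvPolynomial.monomial e c • δ) =
      -proj f (MvPolynomial.monomial e c • δ) := by rw [map_sub, h0, zero_sub]
  have hp0 : proj f (α - MvPolynomial.monomial e c • δ) ≠ 0 := by
    rw [hp]
    exact neg_ne_zero.mpr hl'.proj_ne_zero
  obtain ⟨S, hS⟩ := SigGB.exists_isLead (ord := ord) (mord := mord) hp0
  obtain ⟨δ', hδ', U', d', e', hl'', he, hle⟩ := h.top_reducible S _ hS.sig_eq hp0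
  rw [hp, ord.degree_neg, hl'.degree_eq] at he
  exact hirr δ' hδ' U' d' e' hl'' he (lt_of_le_of_lt hle (hlt S hS.sig_eq))

/-- A singular step may change the signature, so the induction runs on the lead monomial of the
image, over all vectors at once. -/
theorem AllCovered.sReducesToZero (h : AllCovered ord mord f G H) (α : FreeMod σ K m) :
    SReducesToZero ord mord f G α := by
  induction hx : ord.toSyn (ord.degree (proj f α)) using
    (wellFounded_lt (α := ord.syn)).induction generalizing α with
  | _ x ih =>
  subst hx
  by_cases h0 : proj f α = 0
  · exact ⟨α, Relation.ReflTransGen.refl, h0⟩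
  obtain ⟨T, hT⟩ := SigGB.exists_isLead (ord := ord) (mord := mord) h0
  obtain ⟨δ, hδ, U, d, e, hl, he, hle⟩ := h.top_reducible T α hT.sig_eq h0
  obtain ⟨c, hr, -⟩ := hl.exists_sReducesTerm h0 hT.sig_eq he hle
  have hstep : SStep ord mord f G α (α - MvPolynomial.monomial e c • δ) :=
    ⟨δ, hδ, _, e, c, hr, rfl⟩
  by_cases h1 : proj f (α - MvPolynomial.monomial e c • δ) = 0
  · exact ⟨_, Relation.ReflTransGen.single hstep, h1⟩
  have hlt := degree_sub_lt_of_leadingTerm_eq h0 hr.2.2.1 (by rwa [← map_sub])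
  rw [← map_sub] at hlt
  obtain ⟨γ, hγ, hγ0⟩ := ih _ hlt _ rfl
  exact ⟨γ, hγ.head hstep, hγ0⟩

theorem AllCovered.isSigGB (h : AllCovered ord mord f G H) : IsSigGB ord mord f G :=
  fun _ α _ => h.sReducesToZero α

theorem AllCovered.isModuleGB (h : AllCovered ord mord f G H) :
    IsModuleGB mord (SigGB.syz f) H := by
  refine ⟨fun η hη => LinearMap.mem_ker.mpr (h.syz η hη), ?_⟩
  have key : ∀ (T : ModMonomial σ m) (α : FreeMod σ K m), sig mord α = T → proj f α = 0 →
      Relation.ReflTransGen (ModStep mord H) α 0 := by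
    intro T
    induction T using mord.wellFounded_lt.induction with
    | _ T ih =>
    intro α hα h0
    obtain ⟨η, hη, U, e, hs, hU⟩ := h.exists_sig_dvd hα h0
    obtain ⟨c, -, h1, h2⟩ := exists_modCoeff_monomial_smul_eq hα hs hU
    have hstep : ModStep mord H α (α - MvPolynomial.monomial e c • η) :=
      ⟨η, hη, T, e, c, (sig_eq_coe_iff.mp hα).1, h1, h2, rfl⟩
    by_cases hz : α - MvPolynomial.monomial e c • η = 0
    · exact Relation.ReflTransGen.single (hz ▸ hstep)
    obtain ⟨S, hS⟩ := exists_sig_eq (mord := mord) hz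
    refine (ih S (sig_sub_lt hα h1 h2.symm hS) _ hS ?_).head hstep
    rw [map_sub, map_smul, h0, h.syz η hη, smul_zero, sub_zero]
  intro α hα
  by_cases hz : α = 0
  · rw [hz]
  obtain ⟨T, hT⟩ := exists_sig_eq (mord := mord) hz
  exact key T α hT hα

theorem IsModuleGB.span_eq {N : Submodule (MvPolynomial σ K) (FreeMod σ K m)}
    (h : IsModuleGB mord N H) :
    Submodule.span (MvPolynomial σ K) (H : Set (FreeMod σ K m)) = N := by
  refine le_antisymm (Submodule.span_le.mpr h.1) fun α hα => ?_
  have := h.2 α hα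
  clear hα
  induction this using Relation.ReflTransGen.head_induction_on with
  | refl => exact zero_mem _
  | head hstep _ ih =>
    obtain ⟨η, hη, T, e, c, -, -, -, rfl⟩ := hstep
    exact (Submodule.sub_mem_iff_left _
      (Submodule.smul_mem _ _ (Submodule.subset_span hη))).mp ih

end Correctness

/-! ### The invariant of the algorithm: covered or pending -/

section Invariant

variable {σ K : Type*} [Field K] {m : ℕ} {ord : MonomialOrder σ} {mord : ModMonomialOrder σ m}
  {f : Fin m → MvPolynomial σ K}

/-- The subtracted multiple has strictly smaller signature, and its image has no term above the
cancelled one. -/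
theorem RegularSStep.spec {G : Finset (FreeMod σ K m)} {γ γ' : FreeMod σ K m}
    (h : RegularSStep ord mord f G γ γ') :
    sig mord γ' = sig mord γ ∧ proj f γ ≠ 0 ∧
      ord.toSyn (ord.degree (proj f γ')) ≤ ord.toSyn (ord.degree (proj f γ)) ∧
      TermsLT ord (proj f γ') (proj f γ) := by
  let := mord.toLinearOrder
  obtain ⟨β, -, d, e, c, hr, hne, rfl⟩ := h
  obtain ⟨U, d', -, -, hs⟩ := hr.exists_isLead
  obtain ⟨hd, hc, hl, hle⟩ := hr
  rw [MvPolynomial.mem_support_iff] at hd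
  have hγ : proj f γ ≠ 0 := by
    rintro h0
    simp [h0] at hd
  obtain ⟨T, hT⟩ := exists_isLead (ord := ord) (mord := mord) hγ
  rw [hs, hT.sig_eq, sigLE_coe] at hle
  rw [hs, hT.sig_eq] at hne
  refine ⟨?_, hγ, ?_, ?_⟩
  · rw [sig_sub_eq_left hT.sig_eq hs (lt_of_le_of_ne hle fun h => hne (congrArg _ h)), hT.sig_eq]
  · rw [map_sub]
    exact degree_sub_le_of_leadingTerm_eq hd hl
  · rw [map_sub]
    obtain ⟨h1, h2⟩ := coeff_sub_of_leadingTerm_eq hd hl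
    exact ⟨d, h2, h1, hd⟩

variable (ord mord f) in
/-- `p` has signature `S`, and its image is zero or has a lead monomial below `D`. -/
def HasSigBelow (S : ModMonomial σ m) (D : WithTop ord.syn) (p : FreeMod σ K m) : Prop :=
  sig mord p = S ∧ (proj f p = 0 ∨ (ord.toSyn (ord.degree (proj f p)) : WithTop ord.syn) < D)

theorem HasSigBelow.of_regularSStep {G : Finset (FreeMod σ K m)} {S : ModMonomial σ m}
    {D : WithTop ord.syn} {γ γ' : FreeMod σ K m} (hγ : HasSigBelow ord mord f S D γ)
    (h : RegularSStep ord mord f G γ γ') : HasSigBelow ord mord f S D γ' := by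
  obtain ⟨h1, h2, h3, -⟩ := h.spec
  exact ⟨h1.trans hγ.1, Or.inr (lt_of_le_of_lt (WithTop.coe_le_coe.mpr h3)
    (hγ.2.resolve_left h2))⟩

theorem IsLead.spairPart {α β : FreeMod σ K m} {U V : ModMonomial σ m} {d d' : σ →₀ ℕ}
    (hα : IsLead ord mord f α U d) (hβ : IsLead ord mord f β V d') :
    IsLead ord mord f (spairPart ord f α β) (U.mul (d ⊔ d' - d)) (d ⊔ d') ∧
      ord.leadingTerm (proj f (SigGB.spairPart ord f α β)) =
        MvPolynomial.monomial (d ⊔ d') 1 := by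
  have h0 := ord.leadingCoeff_ne_zero_iff.mpr hα.proj_ne_zero
  have h1 := hα.monomial_smul (d ⊔ d' - d) (inv_ne_zero h0)
  rw [tsub_add_cancel_of_le le_sup_left] at h1
  have h2 : SigGB.spairPart ord f α β =
      MvPolynomial.monomial (d ⊔ d' - d) (ord.leadingCoeff (proj f α))⁻¹ • α := by
    rw [SigGB.spairPart, hα.degree_eq, hβ.degree_eq]
  rw [h2]
  refine ⟨h1, ?_⟩
  rw [MonomialOrder.leadingTerm, h1.degree_eq, map_smul, smul_eq_mul,
    (degree_leadingCoeff_monomial_mul hα.proj_ne_zero _ (inv_ne_zero h0)).2, inv_mul_cancel₀ h0]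

/-- The two halves have the same monic lead term, which cancels, while the larger signature
survives. -/
theorem hasSigBelow_spair {α β : FreeMod σ K m} {U V : ModMonomial σ m} {d d' : σ →₀ ℕ}
    (hα : IsLead ord mord f α U d) (hβ : IsLead ord mord f β V d')
    (h : mord.toLinearOrder.lt (V.mul (d ⊔ d' - d')) (U.mul (d ⊔ d' - d))) :
    HasSigBelow ord mord f (U.mul (d ⊔ d' - d)) (ord.toSyn (d ⊔ d')) (spair ord f α β) := by
  obtain ⟨h1, h2⟩ := hα.spairPart hβ
  obtain ⟨h3, h4⟩ := hβ.spairPart hα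
  rw [sup_comm d' d] at h3 h4
  refine ⟨sig_sub_eq_left h1.sig_eq h3.sig_eq h, ?_⟩
  by_cases h0 : proj f (spair ord f α β) = 0
  · exact Or.inl h0
  rw [spair, map_sub] at h0 ⊢
  have := degree_sub_lt_of_leadingTerm_eq h1.proj_ne_zero (h4.trans h2.symm) h0
  rw [h1.degree_eq] at this
  exact Or.inr (WithTop.coe_lt_coe.mpr this)

theorem HasSigBelow.neg {S : ModMonomial σ m} {D : WithTop ord.syn} {p : FreeMod σ K m}
    (h : HasSigBelow ord mord f S D p) : HasSigBelow ord mord f S D (-p) := by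
  rw [HasSigBelow, sig_neg, map_neg, ord.degree_neg, neg_eq_zero]
  exact h

/-- The algorithm puts the newer element second, whichever half has the larger signature; the sign
is immaterial. -/
theorem hasSigBelow_spair_symm {α β : FreeMod σ K m} {U V : ModMonomial σ m} {d d' : σ →₀ ℕ}
    (hα : IsLead ord mord f α U d) (hβ : IsLead ord mord f β V d')
    (h : mord.toLinearOrder.lt (V.mul (d ⊔ d' - d')) (U.mul (d ⊔ d' - d))) :
    HasSigBelow ord mord f (U.mul (d ⊔ d' - d)) (ord.toSyn (d ⊔ d')) (spair ord f β α) := by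
  have := (hasSigBelow_spair hα hβ h).neg
  rwa [spair, neg_sub] at this

theorem sPairRegular_iff {α β : FreeMod σ K m} {U V : ModMonomial σ m} {d d' : σ →₀ ℕ}
    (hα : IsLead ord mord f α U d) (hβ : IsLead ord mord f β V d') :
    SPairRegular ord mord f α β ↔ U.mul (d ⊔ d' - d) ≠ V.mul (d ⊔ d' - d') := by
  rw [SPairRegular, (hα.spairPart hβ).1.sig_eq, (hβ.spairPart hα).1.sig_eq, sup_comm d' d,
    Ne, WithBot.coe_inj]

variable (ord mord f) in
/-- `S` is covered, or will be covered when some pair or the current element is processed. -/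
def Pending (s : State σ K m) (S : ModMonomial σ m) (D : WithTop ord.syn) : Prop :=
  (∃ p ∈ s.pairs, HasSigBelow ord mord f S D p) ∨
    (∃ p ∈ s.current, HasSigBelow ord mord f S D p) ∨
    Covered ord mord f s.basis s.syzygies S D

theorem Covered.mono {G H G' H' : Finset (FreeMod σ K m)} {S : ModMonomial σ m}
    {D : WithTop ord.syn} (h : Covered ord mord f G H S D) (hG : G ⊆ G') (hH : H ⊆ H') :
    Covered ord mord f G' H' S D := by
  rcases h with ⟨η, hη, h⟩ | ⟨δ, hδ, h⟩
  · exact Or.inl ⟨η, hH hη, h⟩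
  · exact Or.inr ⟨δ, hG hδ, h⟩

/-- Reduction keeps the signature and does not raise the lead monomial. A resulting syzygy covers
through `H`, a new basis element covers by itself, and a discarded element is replaced by its
singular reducer, which has the same signature and lead monomial. -/
theorem Pending.step {prec : LinearOrder (FreeMod σ K m)} {s s' : State σ K m}
    {S : ModMonomial σ m} {D : WithTop ord.syn} (h : Pending ord mord f s S D)
    (hs : Step ord mord prec f s s') : Pending ord mord f s' S D := by
  classical
  cases hs with
  | select G H P β mem min =>
    rcases h with ⟨p, hp, h⟩ | ⟨p, hp, -⟩ | h
    · by_cases hpβ : p = β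
      · exact Or.inr (Or.inl ⟨β, rfl, hpβ ▸ h⟩)
      · exact Or.inl ⟨p, Finset.mem_erase.mpr ⟨hpβ, hp⟩, h⟩
    · cases hp
    · exact Or.inr (Or.inr h)
  | reduce G H P γ γ' red =>
    rcases h with h | ⟨p, hp, h⟩ | h
    · exact Or.inl h
    · cases hp
      exact Or.inr (Or.inl ⟨γ', rfl, h.of_regularSStep red⟩)
    · exact Or.inr (Or.inr h)
  | addSyzygy G H P γ irred zero =>
    rcases h with h | ⟨p, hp, h⟩ | h
    · exact Or.inl h
    · cases hp
      exact Or.inr (Or.inr (Or.inl ⟨_, Finset.mem_insert_self _ _, h.1⟩))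
    · exact Or.inr (Or.inr (h.mono subset_rfl (Finset.subset_insert _ _)))
  | discard G H P γ irred nonzero sing =>
    rcases h with h | ⟨p, hp, h⟩ | h
    · exact Or.inl h
    · cases hp
      obtain ⟨δ, hδ, e, c, hr, hs⟩ := sing
      obtain ⟨U, d, hl, he, hs'⟩ := hr.exists_isLead
      refine Or.inr (Or.inr (Or.inr ⟨δ, hδ, U, d, e, hl, ?_, ?_⟩))
      · exact WithBot.coe_inj.mp (hs'.symm.trans (hs.trans h.1))
      · rw [he]
        exact h.2.resolve_left nonzero
    · exact Or.inr (Or.inr h)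
  | addBasis G H P γ irred nonzero nonsing =>
    rcases h with ⟨p, hp, h⟩ | ⟨p, hp, h⟩ | h
    · exact Or.inl ⟨p, Finset.mem_union_left _ hp, h⟩
    · cases hp
      refine Or.inr (Or.inr (Or.inr ⟨γ, Finset.mem_insert_self _ _, S, _, 0,
        ⟨nonzero, h.1, rfl⟩, S.mul_zero, ?_⟩))
      rw [zero_add]
      exact h.2.resolve_left nonzero
    · exact Or.inr (Or.inr (h.mono (Finset.subset_insert _ _) subset_rfl))

variable (ord mord f) in
/-- All unit vectors and all regular S-pairs are covered or pending. -/
structure AllPending (s : State σ K m) : Prop where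
  syz : ∀ h ∈ s.syzygies, proj f h = 0
  unit : ∀ i, Pending ord mord f s ⟨i, 0⟩ ⊤
  pair : ∀ α ∈ s.basis, ∀ β ∈ s.basis, ∀ U d V d', IsLead ord mord f α U d →
    IsLead ord mord f β V d' →
    mord.toLinearOrder.lt (V.mul (d ⊔ d' - d')) (U.mul (d ⊔ d' - d)) →
    Pending ord mord f s (U.mul (d ⊔ d' - d)) (ord.toSyn (d ⊔ d'))

theorem sig_unitVec (i : Fin m) :
    sig mord (unitVec i : FreeMod σ K m) = (⟨i, 0⟩ : ModMonomial σ m) := by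
  classical
  let := mord.toLinearOrder
  rw [sig_eq_coe_iff]
  refine ⟨by simp [modCoeff, unitVec], ?_⟩
  rintro ⟨j, e⟩ h
  have : (⟨j, e⟩ : ModMonomial σ m) = ⟨i, 0⟩ := by
    by_cases hj : j = i
    · subst hj
      simp only [modCoeff, unitVec, Pi.single_eq_same, MvPolynomial.coeff_one] at h
      split_ifs at h with h'
      · rw [h']
      · exact absurd rfl h
    · simp [modCoeff, unitVec, Pi.single_eq_of_ne hj] at h
  exact le_of_eq this

theorem allPending_init : AllPending ord mord f (State.init σ K m) := by
  classical
  refine ⟨by simp [State.init], fun i => Or.inl ⟨unitVec i, ?_, sig_unitVec i, ?_⟩,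
    by simp [State.init]⟩
  · exact Finset.mem_image_of_mem _ (Finset.mem_univ i)
  · exact Or.inr (WithTop.coe_lt_top _)

theorem AllPending.step {prec : LinearOrder (FreeMod σ K m)} {s s' : State σ K m}
    (h : AllPending ord mord f s) (hs : Step ord mord prec f s s') :
    AllPending ord mord f s' := by
  classical
  refine ⟨?_, fun i => (h.unit i).step hs, ?_⟩
  · cases hs with
    | addSyzygy G H P γ irred zero =>
      intro η hη
      rcases Finset.mem_insert.mp hη with rfl | hη
      · exact zero
      · exact h.syz η hη
    | _ => exact h.syz
  · intro α hα β hβ U d V d' hlα hlβ hlt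
    by_cases hold : α ∈ s.basis ∧ β ∈ s.basis
    · exact (h.pair α hold.1 β hold.2 U d V d' hlα hlβ hlt).step hs
    cases hs with
    | addBasis G H P γ irred nonzero nonsing =>
      have hne : U.mul (d ⊔ d' - d) ≠ V.mul (d ⊔ d' - d') := by
        let := mord.toLinearOrder
        exact ne_of_gt hlt
      left
      rcases Finset.mem_insert.mp hα with rfl | hαG <;>
        rcases Finset.mem_insert.mp hβ with rfl | hβG
      -- An element paired with itself has equal halves, so the pair is not regular.
      · have h1 : d = d' := hlα.degree_eq.symm.trans hlβ.degree_eq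
        have h2 : U = V := WithBot.coe_inj.mp (hlα.sig_eq.symm.trans hlβ.sig_eq)
        exact absurd (by rw [h1, h2]) hne
      · refine ⟨spair ord f β α, Finset.mem_union_right _ (Finset.mem_image_of_mem _
          (Finset.mem_filter.mpr ⟨hβG, ?_⟩)), hasSigBelow_spair_symm hlα hlβ hlt⟩
        rw [sPairRegular_iff hlβ hlα, sup_comm]
        exact hne.symm
      · refine ⟨spair ord f α β, Finset.mem_union_right _ (Finset.mem_image_of_mem _
          (Finset.mem_filter.mpr ⟨hαG, ?_⟩)), hasSigBelow_spair hlα hlβ hlt⟩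
        rw [sPairRegular_iff hlα hlβ]
        exact hne
      · exact absurd ⟨hαG, hβG⟩ hold
    | _ => exact absurd ⟨hα, hβ⟩ hold

theorem AllPending.allCovered {s : State σ K m} (h : AllPending ord mord f s) (hs : s.Halted) :
    AllCovered ord mord f s.basis s.syzygies := by
  have key : ∀ S D, Pending ord mord f s S D → Covered ord mord f s.basis s.syzygies S D := by
    rintro S D (⟨p, hp, -⟩ | ⟨p, hp, -⟩ | h)
    · simp [hs.2] at hp
    · simp [hs.1] at hp
    · exact h
  exact ⟨h.syz, fun i => key _ _ (h.unit i), fun α hα β hβ U d V d' h1 h2 h3 =>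
    key _ _ (h.pair α hα β hβ U d V d' h1 h2 h3)⟩

end Invariant

/-! ### Dickson's lemma and bad sequences -/

section Dickson

variable {σ : Type*} {m : ℕ}

/-- Divisibility of pairs consisting of a module monomial and an exponent vector. -/
def DataDvd (x y : ModMonomial σ m × (σ →₀ ℕ)) : Prop :=
  x.1.index = y.1.index ∧ x.1.exponent ≤ y.1.exponent ∧ x.2 ≤ y.2

theorem wellQuasiOrdered_dataDvd [Finite σ] :
    WellQuasiOrdered (DataDvd : ModMonomial σ m × (σ →₀ ℕ) → _ → Prop) := by
  intro g
  have h1 : WellQuasiOrdered ((· = ·) : Fin m → Fin m → Prop) := Finite.wellQuasiOrdered _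
  have h2 : WellQuasiOrdered ((· ≤ ·) : (σ →₀ ℕ) → (σ →₀ ℕ) → Prop) := wellQuasiOrdered_le
  exact h1.prod (h2.prod h2) fun n => ((g n).1.index, (g n).1.exponent, (g n).2)

/-- The relation of extending a list by an element that is divisible by no entry. -/
def BadExtension (l' l : List (ModMonomial σ m × (σ →₀ ℕ))) : Prop :=
  ∃ x, l' = x :: l ∧ ∀ y ∈ l, ¬ DataDvd y x

/-- The entries added along an infinite chain would form an infinite sequence in which no entry
divides a later one. -/
theorem wellFounded_badExtension [Finite σ] :
    WellFounded (BadExtension : List (ModMonomial σ m × (σ →₀ ℕ)) → _ → Prop) := by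
  refine wellFounded_iff_isEmpty_descending_chain.mpr ⟨fun ⟨g, hg⟩ => ?_⟩
  choose x hx hbad using hg
  have hmem : ∀ i n, i < n → x i ∈ g n := by
    intro i n hin
    induction n, hin using Nat.le_induction with
    | base => rw [hx i]; exact List.mem_cons_self
    | succ n _ ih => rw [hx n]; exact List.mem_cons_of_mem _ ih
  obtain ⟨i, j, hij, hd⟩ := wellQuasiOrdered_dataDvd x
  exact hbad j _ (hmem i j hij) hd

end Dickson

/-! ### Termination by growing ratios -/

section Termination

variable {σ K : Type*} [Field K] {m : ℕ} {ord : MonomialOrder σ} {mord : ModMonomialOrder σ m}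
  {f : Fin m → MvPolynomial σ K}

variable (ord mord f) in
/-- `p` is a syzygy, or the ratio of its signature and the lead monomial of its image is larger
than the ratio of the components of `y`. -/
def RatioLT (y : ModMonomial σ m × (σ →₀ ℕ)) (p : FreeMod σ K m) : Prop :=
  proj f p = 0 ∨ ∃ S : ModMonomial σ m, sig mord p = S ∧
    mord.toLinearOrder.lt (y.1.mul (ord.degree (proj f p))) (S.mul y.2)

theorem RatioLT.of_regularSStep (hcompat : Compatible ord mord) {G : Finset (FreeMod σ K m)}
    {y : ModMonomial σ m × (σ →₀ ℕ)} {γ γ' : FreeMod σ K m} (h : RatioLT ord mord f y γ)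
    (hs : RegularSStep ord mord f G γ γ') : RatioLT ord mord f y γ' := by
  let := mord.toLinearOrder
  obtain ⟨h1, h2, h3, -⟩ := hs.spec
  obtain ⟨S, hS, hlt⟩ := h.resolve_left h2
  refine Or.inr ⟨S, h1.trans hS, lt_of_le_of_lt (not_lt.mp fun h => ?_) hlt⟩
  exact absurd (hcompat.mul_lt_mul_iff.mp h) (not_lt_of_ge h3)

theorem RatioLT.trans {y : ModMonomial σ m × (σ →₀ ℕ)} {γ p : FreeMod σ K m}
    {S : ModMonomial σ m} {d : σ →₀ ℕ} (hγ : IsLead ord mord f γ S d)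
    (h : RatioLT ord mord f y γ) (hp : RatioLT ord mord f (S, d) p) :
    RatioLT ord mord f y p := by
  let := mord.toLinearOrder
  rcases hp with hp | ⟨W, hW, hlt⟩
  · exact Or.inl hp
  obtain ⟨S', hS', hlt'⟩ := h.resolve_left hγ.proj_ne_zero
  obtain rfl : S' = S := WithBot.coe_inj.mp (hS'.symm.trans hγ.sig_eq)
  rw [hγ.degree_eq] at hlt'
  -- Transitivity of fractions: cross-multiply both inequalities, then cancel the middle denominator
  -- `d`.
  refine Or.inr ⟨W, hW, (mul_lt_mul_mod_iff d).mp ?_⟩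
  have h1 := mul_lt_mul_mod (ord.degree (proj f p)) hlt'
  have h2 := mul_lt_mul_mod y.2 hlt
  simp only [ModMonomial.mul_mul] at h1 h2 ⊢
  rw [add_comm _ d, add_comm _ y.2] at h1
  rw [add_comm y.2 d] at h2
  exact lt_trans h1 h2

/-- As fractions, `S / d = S (L / d) / L ≤ T / L`, and the last ratio grows strictly when `L` is
replaced by the smaller lead monomial of `p`. -/
theorem ratioLT_of_hasSigBelow (hcompat : Compatible ord mord) {S T : ModMonomial σ m}
    {d L : σ →₀ ℕ} {p : FreeMod σ K m} (h : HasSigBelow ord mord f T (ord.toSyn L) p)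
    (hle : mord.toLinearOrder.le (S.mul (L - d)) T) (hd : d ≤ L) :
    RatioLT ord mord f (S, d) p := by
  let := mord.toLinearOrder
  obtain ⟨hs, h | h⟩ := h
  · exact Or.inl h
  refine Or.inr ⟨T, hs, lt_of_lt_of_le
    (hcompat.mul_lt_mul_iff.mpr (WithTop.coe_lt_coe.mp h)) ?_⟩
  have := mord.mul_le_mul d _ _ hle
  rwa [ModMonomial.mul_mul, add_tsub_cancel_of_le hd] at this

variable (ord mord f) in
/-- The entries of `l` are lead data of elements of `G`, with ratios smaller than that of `p`. -/
def IsAncestry (G : Finset (FreeMod σ K m)) (p : FreeMod σ K m)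
    (l : List (ModMonomial σ m × (σ →₀ ℕ))) : Prop :=
  ∀ y ∈ l, (∃ δ ∈ G, IsLead ord mord f δ y.1 y.2) ∧ RatioLT ord mord f y p

theorem IsAncestry.mono {G G' : Finset (FreeMod σ K m)} {p : FreeMod σ K m}
    {l : List (ModMonomial σ m × (σ →₀ ℕ))} (h : IsAncestry ord mord f G p l) (hG : G ⊆ G') :
    IsAncestry ord mord f G' p l := by
  intro y hy
  obtain ⟨⟨δ, hδ, hl⟩, hr⟩ := h y hy
  exact ⟨⟨δ, hG hδ, hl⟩, hr⟩

/-- Suppose `S = a T` and `d` is `d₀` times `b`. The ratio inequality then says `b T < S`, so `b`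
times the ancestor is a regular top reducer of `γ`. -/
theorem IsAncestry.not_dataDvd {G : Finset (FreeMod σ K m)} {γ : FreeMod σ K m}
    {S : ModMonomial σ m} {d : σ →₀ ℕ}
    {l : List (ModMonomial σ m × (σ →₀ ℕ))} (h : IsAncestry ord mord f G γ l)
    (hγ : IsLead ord mord f γ S d) (irred : ∀ γ', ¬ RegularSStep ord mord f G γ γ') :
    ∀ y ∈ l, ¬ DataDvd y (S, d) := by
  let := mord.toLinearOrder
  rintro ⟨T, d₀⟩ hy ⟨hi, hT, hd⟩
  obtain ⟨⟨δ, hδ, hl⟩, hr⟩ := h _ hy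
  obtain ⟨S', hS', hlt⟩ := hr.resolve_left hγ.proj_ne_zero
  obtain rfl : S' = S := WithBot.coe_inj.mp (hS'.symm.trans hγ.sig_eq)
  obtain ⟨a, ha⟩ := exists_add_of_le hT
  obtain ⟨b, hb⟩ := exists_add_of_le hd
  simp only at hi ha hb hlt hl
  have hS : S' = T.mul a := by
    ext1
    · exact hi.symm
    · rw [ha, add_comm]
      rfl
  have hlt' : mord.toLinearOrder.lt (T.mul b) S' := by
    rw [← mul_lt_mul_mod_iff d₀, ModMonomial.mul_mul, ← hb, ← hγ.degree_eq]
    exact hlt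
  obtain ⟨c, hred, hs⟩ := hl.exists_sReducesTerm (e := b) hγ.proj_ne_zero hγ.sig_eq
    (by rw [hγ.degree_eq, hb, add_comm]) (le_of_lt hlt')
  refine irred _ ⟨δ, hδ, _, b, c, hred, ?_, rfl⟩
  rw [hs, hγ.sig_eq]
  exact fun h' => ne_of_lt hlt' (WithBot.coe_inj.mp h')

theorem IsAncestry.spair (hcompat : Compatible ord mord) {G : Finset (FreeMod σ K m)}
    {α γ : FreeMod σ K m} {S : ModMonomial σ m} {d : σ →₀ ℕ}
    {l : List (ModMonomial σ m × (σ →₀ ℕ))} (h : IsAncestry ord mord f G γ l)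
    (hγ : IsLead ord mord f γ S d) (hα : proj f α ≠ 0) (hreg : SPairRegular ord mord f α γ)
    (hmem : γ ∈ G) :
    IsAncestry ord mord f G (spair ord f α γ) ((S, d) :: l) := by
  let := mord.toLinearOrder
  obtain ⟨U, hU⟩ := exists_isLead (ord := ord) (mord := mord) hα
  have hr : RatioLT ord mord f (S, d) (SigGB.spair ord f α γ) := by
    rw [sPairRegular_iff hU hγ] at hreg
    -- The S-pair takes the larger signature, which is at least that of the half from `γ`.
    rcases lt_or_gt_of_ne hreg with hlt | hlt
    · rw [sup_comm] at hlt
      exact ratioLT_of_hasSigBelow hcompat (hasSigBelow_spair_symm hγ hU hlt) (le_refl _)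
        le_sup_left
    · exact ratioLT_of_hasSigBelow hcompat (hasSigBelow_spair hU hγ hlt) (le_of_lt hlt)
        le_sup_right
  intro y hy
  rcases List.mem_cons.mp hy with rfl | hy
  · exact ⟨⟨γ, hmem, hγ⟩, hr⟩
  · exact ⟨(h y hy).1, (h y hy).2.trans hγ hr⟩

variable (ord mord f) in
/-- `lab` and `cur` label the pairs and the current element by their ancestries. -/
structure IsLabelling (s : State σ K m)
    (lab : FreeMod σ K m → List (ModMonomial σ m × (σ →₀ ℕ)))
    (cur : List (ModMonomial σ m × (σ →₀ ℕ))) : Prop where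
  proj_ne_zero : ∀ δ ∈ s.basis, proj f δ ≠ 0
  pairs : ∀ p ∈ s.pairs, IsAncestry ord mord f s.basis p (lab p)
  current : ∀ p ∈ s.current, IsAncestry ord mord f s.basis p cur

/-- The termination measure: the labels of the pairs and the current element, and the state of the
reduction. -/
noncomputable def labelMeasure (f : Fin m → MvPolynomial σ K) (s : State σ K m)
    (lab : FreeMod σ K m → List (ModMonomial σ m × (σ →₀ ℕ)))
    (cur : List (ModMonomial σ m × (σ →₀ ℕ))) :
    Multiset (List (ModMonomial σ m × (σ →₀ ℕ))) × ℕ × MvPolynomial σ K :=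
  match s.current with
  | none => (s.pairs.val.map lab, 1, 0)
  | some γ => (s.pairs.val.map lab + {cur}, 0, proj f γ)

variable (K m) in
/-- The order on the values of the termination measure. -/
def LabelLT (ord : MonomialOrder σ) :
    Multiset (List (ModMonomial σ m × (σ →₀ ℕ))) × ℕ × MvPolynomial σ K →
    Multiset (List (ModMonomial σ m × (σ →₀ ℕ))) × ℕ × MvPolynomial σ K → Prop :=
  Prod.Lex (Relation.CutExpand BadExtension) (Prod.Lex (· < ·) (TermsLT ord))

theorem wellFounded_labelLT [Finite σ] (ord : MonomialOrder σ) :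
    WellFounded (LabelLT K m ord) :=
  wellFounded_badExtension.cutExpand.prod_lex (wellFounded_lt.prod_lex (wellFounded_termsLT ord))

theorem IsLabelling.step (hcompat : Compatible ord mord) {prec : LinearOrder (FreeMod σ K m)}
    {s s' : State σ K m} {lab : FreeMod σ K m → List (ModMonomial σ m × (σ →₀ ℕ))}
    {cur : List (ModMonomial σ m × (σ →₀ ℕ))} (h : IsLabelling ord mord f s lab cur)
    (hs : Step ord mord prec f s s') :
    ∃ lab' cur', IsLabelling ord mord f s' lab' cur' ∧
      LabelLT K m ord (labelMeasure f s' lab' cur') (labelMeasure f s lab cur) := by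
  classical
  obtain ⟨hG, hP, hc⟩ := h
  have drop : ∀ (M : Multiset (List (ModMonomial σ m × (σ →₀ ℕ)))) x y,
      LabelLT K m ord (M, x) (M + {cur}, y) := fun M x y =>
    Prod.Lex.left _ _ ⟨0, cur, by simp, by simp⟩
  cases hs with
  | select G H P β mem min =>
    refine ⟨lab, lab β, ⟨hG, fun p hp => hP p (Finset.mem_of_mem_erase hp), ?_⟩, ?_⟩
    · rintro p hp
      cases hp
      exact hP β mem
    -- Selection moves the label of `β` without changing the multiset; the flag dropping from 1 to 0
    -- gives the decrease.
    · have : (P.erase β).val.map lab + {lab β} = P.val.map lab := by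
        conv_rhs => rw [← Multiset.cons_erase (Finset.mem_val.mpr mem)]
        rw [Multiset.map_cons, Finset.erase_val, ← Multiset.singleton_add, add_comm]
      simp only [labelMeasure, this]
      exact Prod.Lex.right _ (Prod.Lex.left _ _ zero_lt_one)
  | reduce G H P γ γ' red =>
    refine ⟨lab, cur, ⟨hG, hP, ?_⟩, Prod.Lex.right _ (Prod.Lex.right _ red.spec.2.2.2)⟩
    rintro p hp
    cases hp
    exact fun y hy => ⟨(hc γ rfl y hy).1, (hc γ rfl y hy).2.of_regularSStep hcompat red⟩
  | addSyzygy G H P γ irred zero =>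
    exact ⟨lab, cur, ⟨hG, hP, fun p hp => by cases hp⟩, drop _ _ _⟩
  | discard G H P γ irred nonzero sing =>
    exact ⟨lab, cur, ⟨hG, hP, fun p hp => by cases hp⟩, drop _ _ _⟩
  | addBasis G H P γ irred nonzero nonsing =>
    obtain ⟨S, hγ⟩ := exists_isLead (ord := ord) (mord := mord) nonzero
    have hcur := hc γ rfl
    set Q := (G.filter fun α => SPairRegular ord mord f α γ).image fun α => spair ord f α γ
      with hQ
    -- An S-pair already in `P` keeps its old label, so only the elements of `Q \ P` receive the
    -- extended label.
    refine ⟨fun p => if p ∈ P then lab p else (S, ord.degree (proj f γ)) :: cur, cur,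
      ⟨?_, ?_, fun p hp => by cases hp⟩, ?_⟩
    · intro δ hδ
      rcases Finset.mem_insert.mp hδ with rfl | hδ
      · exact nonzero
      · exact hG δ hδ
    · intro p hp
      by_cases hpP : p ∈ P
      · simp only [if_pos hpP]
        exact (hP p hpP).mono (Finset.subset_insert _ _)
      · simp only [if_neg hpP]
        obtain ⟨α, hα, rfl⟩ :=
          Finset.mem_image.mp ((Finset.mem_union.mp hp).resolve_left hpP)
        rw [Finset.mem_filter] at hα
        exact (hcur.mono (Finset.subset_insert _ _)).spair hcompat hγ (hG α hα.1) hα.2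
          (Finset.mem_insert_self _ _)
    -- The label `cur` is replaced by one copy of its extension for each genuinely new pair.
    · refine Prod.Lex.left _ _ ⟨(Q \ P).val.map
        fun _ => (S, ord.degree (proj f γ)) :: cur, cur, ?_, ?_⟩
      · intro l hl
        obtain ⟨-, -, rfl⟩ := Multiset.mem_map.mp hl
        exact ⟨_, rfl, hcur.not_dataDvd hγ irred⟩
      · have hval : (P ∪ Q).val = P.val + (Q \ P).val := by
          rw [← Finset.union_sdiff_self_eq_union, ← Finset.disjUnion_eq_union _ _
            Finset.disjoint_sdiff, Finset.disjUnion_val]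
        rw [hval, Multiset.map_add,
          Multiset.map_congr rfl (g := lab) fun p hp => if_pos (Finset.mem_val.mp hp),
          Multiset.map_congr rfl (g := fun _ => (S, ord.degree (proj f γ)) :: cur)
            fun p (hp : p ∈ (Q \ P).val) => if_neg (Finset.mem_sdiff.mp hp).2]
        exact add_right_comm _ _ _

theorem IsLabelling.acc [Finite σ] (hcompat : Compatible ord mord)
    {prec : LinearOrder (FreeMod σ K m)} {s : State σ K m}
    {lab : FreeMod σ K m → List (ModMonomial σ m × (σ →₀ ℕ))}
    {cur : List (ModMonomial σ m × (σ →₀ ℕ))} (h : IsLabelling ord mord f s lab cur) :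
    Acc (fun t' t => Step ord mord prec f t t') s := by
  induction hx : labelMeasure f s lab cur using (wellFounded_labelLT ord).induction
    generalizing s lab cur with
  | _ x ih =>
  subst hx
  refine ⟨_, fun s' hs => ?_⟩
  obtain ⟨lab', cur', h', hlt⟩ := h.step hcompat hs
  exact ih _ hlt h' rfl

theorem isLabelling_init : IsLabelling ord mord f (State.init σ K m) (fun _ => []) [] :=
  ⟨by simp [State.init], fun _ _ => List.forall_mem_nil _, fun _ _ => List.forall_mem_nil _⟩

theorem exists_step_of_not_halted (ord : MonomialOrder σ) (mord : ModMonomialOrder σ m)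
    (f : Fin m → MvPolynomial σ K) (prec : LinearOrder (FreeMod σ K m)) {s : State σ K m}
    (h : ¬ s.Halted) : ∃ s', Step ord mord prec f s s' := by
  obtain ⟨G, H, P, cur⟩ := s
  cases cur with
  | none =>
    have hP : P.Nonempty := by
      by_contra h'
      exact h ⟨rfl, Finset.not_nonempty_iff_eq_empty.mp h'⟩
    obtain ⟨β, hβ, hmin⟩ := P.exists_min_image id hP
    exact ⟨_, .select G H P β hβ hmin⟩
  | some γ =>
    by_cases hred : ∃ γ', RegularSStep ord mord f G γ γ'
    · exact ⟨_, .reduce G H P γ _ hred.choose_spec⟩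
    have irred := not_exists.mp hred
    by_cases h0 : proj f γ = 0
    · exact ⟨_, .addSyzygy G H P γ irred h0⟩
    by_cases hsing : SingularTopReducible ord mord f G γ
    · exact ⟨_, .discard G H P γ irred h0 hsing⟩
    · exact ⟨_, .addBasis G H P γ irred h0 hsing⟩

theorem Reachable.allPending {prec : LinearOrder (FreeMod σ K m)} {s : State σ K m}
    (h : Reachable ord mord prec f s) : AllPending ord mord f s := by
  induction h with
  | refl => exact allPending_init
  | tail _ hs ih => exact ih.step hs

end Termination

end SigGB

theorem mainTheorem1 {σ K : Type*} [Finite σ] [Field K] {m : ℕ}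
    (f : Fin m → MvPolynomial σ K)
    (ord : MonomialOrder σ) (mord : SigGB.ModMonomialOrder σ m)
    (hcompat : SigGB.Compatible ord mord)
    (prec : LinearOrder (SigGB.FreeMod σ K m)) :
    -- every run is finite
    (¬ ∃ run : ℕ → SigGB.State σ K m, run 0 = SigGB.State.init σ K m ∧
      ∀ k, SigGB.Step ord mord prec f (run k) (run (k + 1))) ∧
    -- a run can end only where the algorithm returns
    (∀ s, SigGB.Reachable ord mord prec f s → ¬ s.Halted →
      ∃ s', SigGB.Step ord mord prec f s s') ∧
    -- what it returns is correct
    (∀ s, SigGB.Reachable ord mord prec f s → s.Halted →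
      SigGB.IsSigGB ord mord f s.basis ∧
      SigGB.IsModuleGB mord (SigGB.syz f) s.syzygies ∧
      Submodule.span (MvPolynomial σ K) (s.syzygies : Set (SigGB.FreeMod σ K m)) =
        SigGB.syz f) := by
  refine ⟨?_, fun s _ hs => SigGB.exists_step_of_not_halted ord mord f prec hs, ?_⟩
  · rintro ⟨run, h0, hrun⟩
    have hacc : Acc (fun t' t => SigGB.Step ord mord prec f t t') (SigGB.State.init σ K m) :=
      SigGB.isLabelling_init.acc hcompat
    rw [← h0] at hacc
    exact not_acc_iff_exists_descending_chain.mpr ⟨run, rfl, hrun⟩ hacc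
  · intro s hs hhalt
    have h := hs.allPending.allCovered hhalt
    exact ⟨h.isSigGB, h.isModuleGB, h.isModuleGB.span_eq⟩
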